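/- Let $V$ be a finite set of $n$ vertices carrying a directed network with one of the two standard influence models: the linear threshold (LT) model with edge weights $w_{uv}\ge 0$ and self-weights $w_v\ge 0$, where $p_{uv}=w_{uv}/(w_v+\sum_{u'\in N^{in}(v)}w_{u'v})$ ($0$ if the denominator vanishes), the thresholds $\lambda_v$ are independent and uniform on $[0,1]$, and an inactive $v$ becomes active as soon as the sum of $p_{uv}$ over its active in-neighbours $u$ is at least $\lambda_v$; or the independent cascade (IC) model with edge probabilities $w_{uv}\in[0,1]$, where each newly activated $u$ has a single chance to activate each inactive out-neighbour $v$, independently with probability $w_{uv}$. Let $I_u$ be the expected number of finally active vertices when the seed set is $\{u\}$, let $1\le k\le n$, and let $I^k$ be the $k$-th largest of the values $I_u$ (with multiplicity). A random RR set is obtained by picking $v\in V$ uniformly at random, drawing a random set of live edges (LT: every vertex independently picks at most one incoming edge, the edge $(u,v)$ with probability $p_{uv}$; IC: every edge $(u,v)$ is kept independently with probability $w_{uv}$), and taking all vertices that can reach $v$ through live edges. Put $\Upsilon_1(\epsilon,\delta)=1+(1+\epsilon)\,4(e-2)\ln(2/\delta)/\epsilon^2$. Let $0<\epsilon\le\frac13$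 and $0<\delta\le\frac14$. Let $R_1^{(1)},R_1^{(2)},\dots$ be i.i.d. random RR sets, let $M$ be a random nonnegative integer (it may depend on the $R_1^{(i)}$), and let $R_2^{(1)},R_2^{(2)},\dots$ be i.i.d. random RR sets, this second sequence being independent of the first sequence together with $M$. Consider the samples $\mathcal R_1=\{R_1^{(1)},\dots,R_1^{(M)}\}$ and $\mathcal R_2=\{R_2^{(1)},\dots,R_2^{(M)}\}$ of equal size, let $\mathcal D_j(u)$ be the number of sets of $\mathcal R_j$ that contain $u$, and let $\mathcal D_1^k$ be the $k$-th largest of the values $\mathcal D_1(u)$ (with multiplicity). Assume that $M$ is chosen so that, almost surely, $\mathcal D_1^k=\lceil\Upsilon_1(\epsilon,\delta/n)\rceil$. Let $$S=\Big\{u\in V : \mathcal D_2(u)\ge \tfrac{1-\epsilon}{1+\epsilon}\,\mathcal D_1^k\Big\},\qquad B=4(e-2)\ln\tfrac{2n}{\delta}.$$ Then with probability at least $1-2\delta$ the set $S$ contains every $v$ with $I_v\ge I^k$ and $$\min_{u\in S} I_u\ \ge\ \Big[\Big(1-\tfrac{\epsilon^2}{B}\Big)\tfrac{(1-\epsilon)^2}{1+\epsilon}-\epsilon\Big]I^k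 .$$ Moreover, $\big[(1-\frac{\epsilon^2}{B})\frac{(1-\epsilon)^2}{1+\epsilon}-\epsilon\big]I^k\ge(1-\tfrac{61}{15}\epsilon)I^k$. -/

import Mathlib

open MeasureTheory ProbabilityTheory
open scoped NNReal ENNReal

noncomputable section

/-! ### Products of finite probability distributions -/

/-- The joint distribution of independent choices, the `i`-th one distributed according to `p i`. -/
def indepPMF {ι α : Type*} [Fintype ι] [DecidableEq ι] [Fintype α] (p : ι → PMF α) :
    PMF (ι → α) :=
  PMF.ofFintype (fun c => ∏ i, p i (c i)) (by
    have h : ∀ i, ∑ a, p i a = 1 := fun i => by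
      rw [← tsum_fintype (L := SummationFilter.unconditional α)]; exact (p i).tsum_coe
    rw [← Fintype.prod_sum]
    simp [h])

/-- A coin showing `true` with probability `p`. -/
def coinPMF (p : ℝ≥0) (hp : p ≤ 1) : PMF Bool :=
  PMF.ofFintype (fun b => if b then (p : ℝ≥0∞) else ((1 - p : ℝ≥0) : ℝ≥0∞)) (by
    simp only [Fintype.sum_bool, if_true, Bool.false_eq_true, if_false]
    rw [← ENNReal.coe_add, add_tsub_cancel_of_le hp, ENNReal.coe_one])

/-! ### The linear threshold model -/

/-- A directed network for the linear threshold model: nonnegative edge weights and nonnegative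
self-weights. The values of `weight` outside `edges` are never used. -/
structure LTNetwork (V : Type*) where
  edges : Finset (V × V)
  weight : V → V → ℝ≥0
  selfWeight : V → ℝ≥0

namespace LTNetwork

variable {V : Type*} [Fintype V] [DecidableEq V] (N : LTNetwork V)

/-- The in-neighbours of `v`. -/
def inNbrs (v : V) : Finset V := Finset.univ.filter fun u => (u, v) ∈ N.edges

/-- The total weight `W_v = w_v + ∑_{u ∈ N^in(v)} w_{uv}`. -/
def totalWeight (v : V) : ℝ≥0 := N.selfWeight v + ∑ u ∈ N.inNbrs v, N.weight u v

/-- The influence probability `p_{uv} = w_{uv} / W_v` of the edge `(u, v)`. If `W_v = 0` then all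
the weights at `v` vanish and this is `0`. -/
def prob (u v : V) : ℝ≥0 := N.weight u v / N.totalWeight v

/-- One step of the propagation: an inactive `v` becomes active if the influence probabilities
of the edges from its active in-neighbours sum up to at least the threshold of `v`. -/
def step (thr : V → ℝ) (A : Finset V) : Finset V :=
  A ∪ Finset.univ.filter fun v => thr v ≤ ∑ u ∈ N.inNbrs v ∩ A, (N.prob u v : ℝ)

/-- The vertices that are eventually active when the seed set is `S`. -/
def finalActive (thr : V → ℝ) (S : Finset V) : Set V := {v | ∃ t : ℕ, v ∈ (N.step thr)^[t] S}

/-- The influence spread of `S`: the expected number of eventually active vertices, the thresholds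
being independent and uniform on `[0, 1]`. -/
def spread (S : Finset V) : ℝ :=
  ∫ thr : V → ℝ, ((N.finalActive thr S).ncard : ℝ)
    ∂(Measure.pi fun _ : V => (volume : Measure ℝ).restrict (Set.Icc 0 1))

theorem sum_prob_le_one (v : V) : ∑ u ∈ N.inNbrs v, N.prob u v ≤ 1 := by
  unfold prob
  rw [← Finset.sum_div]
  exact div_le_one_of_le₀ (by unfold totalWeight; exact le_add_self) (zero_le)

/-- The random choice of the live edge into `v`: the edge `(u, v)` is picked with probability
`p_{uv}`, and none with the remaining probability. -/
def pickPMF (v : V) : PMF (Option V) :=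
  PMF.ofFintype (fun o => match o with
    | none => ((1 - ∑ u ∈ N.inNbrs v, N.prob u v : ℝ≥0) : ℝ≥0∞)
    | some u => if u ∈ N.inNbrs v then (N.prob u v : ℝ≥0∞) else 0) (by
    rw [Fintype.sum_option]
    simp only [Finset.sum_ite_mem, Finset.univ_inter]
    rw [← ENNReal.ofNNReal_finsetSum, ← ENNReal.coe_add,
      tsub_add_cancel_of_le (N.sum_prob_le_one v), ENNReal.coe_one])

/-- The distribution of the live-edge relation: every vertex independently picks at most one
incoming edge. -/
def liveEdges : PMF (V → V → Prop) :=
  (indepPMF N.pickPMF).map fun c u v => c v = some u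

end LTNetwork

/-! ### The independent cascade model -/

/-- A directed network for the independent cascade model: every edge carries an influence
probability. The values of `weight` outside `edges` are never used. -/
structure ICNetwork (V : Type*) where
  edges : Finset (V × V)
  weight : V → V → ℝ≥0
  weight_le_one : ∀ u v, (u, v) ∈ edges → weight u v ≤ 1

namespace ICNetwork

variable {V : Type*} [Fintype V] [DecidableEq V] (N : ICNetwork V)

/-- The outcomes of the single attempts along the edges: independent coins, that of the edge
`(u, v)` succeeding with probability `w_{uv}`. -/
def coins : PMF (N.edges → Bool) :=
  indepPMF fun e => coinPMF (N.weight e.1.1 e.1.2) (N.weight_le_one e.1.1 e.1.2 e.2)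

/-- `(u, v)` is an edge along which the attempt succeeds. -/
def Succeeds (c : N.edges → Bool) (u v : V) : Prop := ∃ h : (u, v) ∈ N.edges, c ⟨(u, v), h⟩ = true

open Classical in
/-- One step of the propagation. The state consists of the active vertices and of those activated
in the last step; each of the latter uses its single chance to activate each of its inactive
out-neighbours. -/
def step (c : N.edges → Bool) (s : Finset V × Finset V) : Finset V × Finset V :=
  let new := Finset.univ.filter fun v => v ∉ s.1 ∧ ∃ u ∈ s.2, N.Succeeds c u v
  (s.1 ∪ new, new)

/-- The vertices that are eventually active when the seed set is `S`. -/
def finalActive (c : N.edges → Bool) (S : Finset V) : Set V :=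
  {v | ∃ t : ℕ, v ∈ ((N.step c)^[t] (S, S)).1}

/-- The influence spread of `S`: the expected number of eventually active vertices. -/
def spread (S : Finset V) : ℝ :=
  ∑ c : N.edges → Bool, (N.coins c).toReal * ((N.finalActive c S).ncard : ℝ)

/-- The distribution of the live-edge relation: every edge `(u, v)` is kept independently with
probability `w_{uv}`. -/
def liveEdges : PMF (V → V → Prop) := N.coins.map N.Succeeds

end ICNetwork

/-! ### Influence and random RR sets -/

/-- A social network, together with one of the two influence models. -/
inductive InfluenceNetwork (V : Type*) where
  | linearThreshold (N : LTNetwork V)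
  | independentCascade (N : ICNetwork V)

namespace InfluenceNetwork

variable {V : Type*} [Fintype V] [DecidableEq V]

/-- The influence spread of a seed set. -/
def spread : InfluenceNetwork V → Finset V → ℝ
  | linearThreshold N => N.spread
  | independentCascade N => N.spread

/-- The distribution of the live-edge relation. -/
def liveEdges : InfluenceNetwork V → PMF (V → V → Prop)
  | linearThreshold N => N.liveEdges
  | independentCascade N => N.liveEdges

/-- The influence spread `I_u` of a single vertex. -/
def influence (G : InfluenceNetwork V) (u : V) : ℝ := G.spread {u}

/-- The distribution of a random RR set: pick a vertex `v` uniformly at random and simulate the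
live-edge process; the RR set consists of the vertices that can reach `v` through live edges. -/
def rrSet [Nonempty V] (G : InfluenceNetwork V) : PMF (Set V) :=
  (PMF.uniformOfFintype V).bind fun v =>
    G.liveEdges.map fun live => {u | Relation.ReflTransGen live u v}

end InfluenceNetwork

/-! ### The tracking algorithm -/

/-- The `k`-th largest of the values of `f` (with repetitions), for `1 ≤ k ≤ |V|`: the largest `t`
such that at least `k` vertices have a value that is at least `t`. -/
def kthLargest {V α : Type*} [ConditionallyCompleteLinearOrder α]
    (f : V → α) (k : ℕ) : α :=
  sSup {t | k ≤ {v | t ≤ f v}.ncard}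

open Classical in
/-- The degree of `u` in the collection of the first `m` sets of the sequence `R`. -/
def degree {V : Type*} (R : ℕ → Set V) (m : ℕ) (u : V) : ℕ :=
  ((Finset.range m).filter fun i => u ∈ R i).card

/-- `Υ(ε, δ) = 4 (e - 2) ln (2 / δ) / ε²`. -/
def upsilon (ε δ : ℝ) : ℝ := 4 * (Real.exp 1 - 2) * Real.log (2 / δ) / ε ^ 2

/-- `Υ₁(ε, δ) = 1 + (1 + ε) Υ(ε, δ)`. -/
def upsilonOne (ε δ : ℝ) : ℝ := 1 + (1 + ε) * upsilon ε δ

/-- The answer to a top-`k` query when the two samples consist of the first `m` sets of `R₁` and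
of the first `m` sets of `R₂`: all vertices whose degree in the second sample is at least
`(1 - ε) / (1 + ε)` times the `k`-th largest degree in the first one. -/
def queryAnswer {V : Type*} (ε : ℝ) (k : ℕ) (R₁ R₂ : ℕ → Set V) (m : ℕ) : Set V :=
  {u | (1 - ε) / (1 + ε) * ((kthLargest (degree R₁ m) k : ℕ) : ℝ) ≤ (degree R₂ m u : ℝ)}

end

/-! The influence of a vertex `u` is `n` times the probability `q u` that a random RR set contains
`u` (`InfluenceNetwork.influence_eq`), so that `degree R N u` is a binomial variable with mean
`N * q u`. In the independent cascade model this is a statement about reachability in the graph of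
successful edges. In the linear threshold model it needs a comparison of two random processes: in
both, a vertex is triggered by the active set, monotonically, according to an independent local
state (a threshold, or the choice of a live edge). The probability that such a process runs through
a given increasing sequence of active sets is a product over the vertices, and the factor of a
vertex involves only the probabilities that single sets trigger it, which agree for thresholds and
live edges (`measure_exists_mem_iterate_eq`).

For the guarantee, let `p` be the `k`-th largest of the values `q u`, let `m = ⌈Υ₁(ε, δ / n)⌉`, and
put `N = ⌈m / ((1 + ε) p)⌉` and `U = ⌈m / ((1 - ε) p)⌉`. Since degrees increase with the sample, only
four events for each vertex matter, all at fixed sample sizes: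
* `q u ≤ p`, yet the degree of `u` in the first sample already reaches `m` at size `N - 1`;
* `q u ≥ p`, yet the degree of `u` in the first sample is still at most `m` at size `U`;
* `q u ≥ p`, yet the degree in the second sample is at most `(1 - ε) / (1 + ε) * m` at size `N`;
* `q u` is below the claimed bound, yet the degree in the second sample reaches this threshold at
  size `U`.

If the first two fail for all vertices, every sample size at which the `k`-th largest degree is `m`
lies between `N` and `U`; if the last two fail as well, the query answer is as claimed
(`queryAnswer_spec`). By the Chernoff bounds (`measure_degree_ge_le`, `measure_degree_le_le`) each
event has probability at most `δ / (2 n)`, and the `4 n` of them add up to `2 δ`. How the random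
sample size depends on the samples is irrelevant, because only fixed sizes enter the estimates. -/

/-! ### Progressive activation with independent local states -/

section Activation
variable {V : Type*}

/-- By monotonicity, not being triggered by any set of an increasing sequence means not being
triggered by the last one. -/
theorem measure_forall_lt_not_eq {X Y : Type*} [MeasurableSpace X] [MeasurableSpace Y]
    (μ : Measure X) (ν : Measure Y) [IsProbabilityMeasure μ] [IsProbabilityMeasure ν]
    (g : X → Finset V → Prop) (h : Y → Finset V → Prop)
    (hg : ∀ x, Monotone (g x)) (hh : ∀ y, Monotone (h y))
    (mg : ∀ A, MeasurableSet {x | g x A}) (mh : ∀ A, MeasurableSet {y | h y A})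
    (hgh : ∀ A, μ {x | g x A} = ν {y | h y A})
    {A : ℕ → Finset V} (hA : Monotone A) (T : ℕ) :
    μ {x | ∀ t < T, ¬ g x (A t)} = ν {y | ∀ t < T, ¬ h y (A t)} := by
  cases T with
  | zero => simp
  | succ T =>
    have e1 : {x | ∀ t < T + 1, ¬ g x (A t)} = {x | g x (A T)}ᶜ := by
      ext x
      exact ⟨fun H => H T (Nat.lt_succ_self T),
        fun H t ht hx => H (hg x (hA (Nat.lt_succ_iff.1 ht)) hx)⟩
    have e2 : {y | ∀ t < T + 1, ¬ h y (A t)} = {y | h y (A T)}ᶜ := by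
      ext x
      exact ⟨fun H => H T (Nat.lt_succ_self T),
        fun H t ht hx => H (hh x (hA (Nat.lt_succ_iff.1 ht)) hx)⟩
    rw [e1, e2, prob_compl_eq_one_sub (mg _), prob_compl_eq_one_sub (mh _), hgh]

/-- The event, in the local state space of the vertex `v`, that in the steps up to `T` the vertex
`v` enters exactly when the prescribed sequence `A` of active sets says so. Here `g x B` means that
the active set `B` triggers `v` if its local state is `x`. -/
def FollowsAt {X : Type*} (g : X → Finset V → Prop) (v : V) (A : ℕ → Finset V) (T : ℕ) : Set X :=
  {x | ∀ t < T, (v ∈ A (t + 1) ↔ v ∈ A t ∨ g x (A t))}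

theorem followsAt_of_notMem {X : Type*} (g : X → Finset V → Prop) {v : V}
    {A : ℕ → Finset V} (hA : Monotone A) {T : ℕ} (hv : v ∉ A T) :
    FollowsAt g v A T = {x | ∀ t < T, ¬ g x (A t)} := by
  ext x
  refine forall₂_congr fun t ht => ?_
  have h1 : v ∉ A (t + 1) := fun h => hv (hA ht h)
  have h2 : v ∉ A t := fun h => hv (hA ht.le h)
  simp [h1, h2]

theorem followsAt_succ {X : Type*} (g : X → Finset V → Prop) (v : V) (A : ℕ → Finset V) (T : ℕ) :
    FollowsAt g v A (T + 1) =
      FollowsAt g v A T ∩ {x | v ∈ A (T + 1) ↔ v ∈ A T ∨ g x (A T)} := by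
  ext x
  simp only [FollowsAt, Set.mem_inter_iff, Set.mem_ofPred_eq]
  exact Nat.forall_lt_succ_right

theorem followsAt_succ_of_enters {X : Type*} (g : X → Finset V → Prop) {v : V}
    {A : ℕ → Finset V} (hA : Monotone A) {T : ℕ} (h1 : v ∉ A T) (h2 : v ∈ A (T + 1)) :
    FollowsAt g v A (T + 1) =
      {x | ∀ t < T, ¬ g x (A t)} \ {x | ∀ t < T + 1, ¬ g x (A t)} := by
  rw [followsAt_succ, followsAt_of_notMem g hA h1]
  ext x
  simp only [Set.mem_inter_iff, Set.mem_ofPred_eq, Set.mem_sdiff, h1, h2, true_iff, false_or,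
    Nat.forall_lt_succ_right]
  tauto

theorem forall_lt_succ_not_subset {X : Type*} (g : X → Finset V → Prop) (A : ℕ → Finset V)
    (T : ℕ) : {x | ∀ t < T + 1, ¬ g x (A t)} ⊆ {x | ∀ t < T, ¬ g x (A t)} :=
  Set.ofPred_subset_ofPred.2 fun _ hx t ht => hx t (ht.trans (Nat.lt_succ_self T))

theorem measurableSet_forall_lt_not {X : Type*} [MeasurableSpace X] {g : X → Finset V → Prop}
    (mg : ∀ A, MeasurableSet {x | g x A}) (A : ℕ → Finset V) (T : ℕ) :
    MeasurableSet {x | ∀ t < T, ¬ g x (A t)} := by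
  simp only [Set.ofPred_forall]
  exact .iInter fun t => .iInter fun _ => (mg (A t)).compl

/-- Along an increasing sequence of sets, the probability that `v` behaves as prescribed is
determined by the probabilities of being triggered by a single set. -/
theorem measure_followsAt_eq {X Y : Type*} [MeasurableSpace X] [MeasurableSpace Y]
    (μ : Measure X) (ν : Measure Y) [IsProbabilityMeasure μ] [IsProbabilityMeasure ν]
    (g : X → Finset V → Prop) (h : Y → Finset V → Prop)
    (hg : ∀ x, Monotone (g x)) (hh : ∀ y, Monotone (h y))
    (mg : ∀ A, MeasurableSet {x | g x A}) (mh : ∀ A, MeasurableSet {y | h y A})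
    (hgh : ∀ A, μ {x | g x A} = ν {y | h y A})
    (v : V) {A : ℕ → Finset V} (hA : Monotone A) (T : ℕ) :
    μ (FollowsAt g v A T) = ν (FollowsAt h v A T) := by
  have key := measure_forall_lt_not_eq μ ν g h hg hh mg mh hgh hA
  induction T with
  | zero => simp [FollowsAt]
  | succ T ih =>
    by_cases h2 : v ∈ A (T + 1)
    · by_cases h1 : v ∈ A T
      · simpa [followsAt_succ, h1, h2] using ih
      · rw [followsAt_succ_of_enters g hA h1 h2, followsAt_succ_of_enters h hA h1 h2,
          measure_sdiff (forall_lt_succ_not_subset g A T)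
            (measurableSet_forall_lt_not mg A _).nullMeasurableSet (measure_ne_top _ _),
          measure_sdiff (forall_lt_succ_not_subset h A T)
            (measurableSet_forall_lt_not mh A _).nullMeasurableSet (measure_ne_top _ _), key, key]
    · rw [followsAt_of_notMem g hA h2, followsAt_of_notMem h hA h2, key]

theorem measurableSet_followsAt {X : Type*} [MeasurableSpace X] (g : X → Finset V → Prop)
    (mg : ∀ A, MeasurableSet {x | g x A}) (v : V) (A : ℕ → Finset V) (T : ℕ) :
    MeasurableSet (FollowsAt g v A T) := by
  simp only [FollowsAt, Set.ofPred_forall]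
  refine .iInter fun t => .iInter fun _ => ?_
  by_cases h1 : v ∈ A (t + 1) <;> by_cases h2 : v ∈ A t <;>
    simp only [h1, h2, true_iff, false_iff, true_or, false_or, not_true]
  exacts [.const _, mg (A t), .const _, (mg (A t)).compl]

/-- Following a prescribed sequence of active sets is a product event: one condition on the local
state of each vertex. -/
theorem setOf_iterate_eq {X : Type*} {g : V → X → Finset V → Prop}
    {step : (V → X) → Finset V → Finset V}
    (hstep : ∀ x A v, v ∈ step x A ↔ v ∈ A ∨ g v (x v) A) {S : Finset V} {A : ℕ → Finset V}
    (hS : A 0 = S) (T : ℕ) :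
    {x | ∀ t ≤ T, (step x)^[t] S = A t} = Set.univ.pi fun v => FollowsAt (g v) v A T := by
  ext x
  simp only [Set.mem_ofPred_eq, Set.mem_pi, Set.mem_univ, true_imp_iff, FollowsAt]
  constructor
  · intro H v t ht
    rw [← H (t + 1) ht, ← H t ht.le, Function.iterate_succ_apply', hstep]
  · intro H t
    induction t with
    | zero => exact fun _ => hS.symm
    | succ t ih =>
      intro ht
      rw [Function.iterate_succ_apply', ih (by omega)]
      ext v
      rw [hstep, H v t ht]

theorem monotone_of_iterate {step : Finset V → Finset V} (h : ∀ A, A ⊆ step A) (S : Finset V) :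
    Monotone fun t => step^[t] S :=
  monotone_nat_of_le_succ fun t => by
    rw [Function.iterate_succ_apply']; exact h _

/-- The sequence of active sets in the steps `0, …, T`, started from `S`, for the local states
`x`. It takes values in a finite type, so that its law is determined by the point masses. -/
def activationPath {X : Type*} (step : (V → X) → Finset V → Finset V) (S : Finset V) (T : ℕ)
    (x : V → X) (t : Fin (T + 1)) : Finset V := (step x)^[t] S

/-- A path is followed only if it starts at `S` and increases. The finite path `A` is continued
constantly after time `T`. -/
theorem preimage_activationPath {X : Type*} {g : V → X → Finset V → Prop}
    {step : (V → X) → Finset V → Finset V}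
    (hstep : ∀ x A v, v ∈ step x A ↔ v ∈ A ∨ g v (x v) A) (S : Finset V) (T : ℕ)
    (A : Fin (T + 1) → Finset V) :
    activationPath step S T ⁻¹' {A} =
      {x | A 0 = S ∧ Monotone A ∧
        x ∈ Set.univ.pi fun v => FollowsAt (g v) v (fun t => A (Fin.ofNat (T + 1) (min t T))) T} := by
  have hx : ∀ x, x ∈ activationPath step S T ⁻¹' {A} ↔
      ∀ t ≤ T, (step x)^[t] S = A (Fin.ofNat (T + 1) (min t T)) := by
    intro x
    simp only [Set.mem_preimage, Set.mem_singleton_iff, funext_iff, activationPath]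
    constructor
    · intro H t ht
      rw [← H]
      simp [Nat.min_eq_left ht, Nat.mod_eq_of_lt (Nat.lt_succ_of_le ht)]
    · intro H t
      have := H t (Nat.lt_succ_iff.1 t.2)
      rw [this]
      congr 1
      ext
      simp [Nat.min_eq_left (Nat.lt_succ_iff.1 t.2)]
  have h0 : Fin.ofNat (T + 1) (min 0 T) = 0 := by simp
  ext x
  rw [hx, Set.mem_ofPred_eq]
  constructor
  · intro H
    have hS : A 0 = S := by
      have := H 0 (Nat.zero_le _)
      rw [h0] at this
      exact this.symm
    refine ⟨hS, fun s t hst => ?_, ?_⟩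
    · have := ((hx x).2 H : activationPath step S T x = A)
      rw [← this]
      exact monotone_of_iterate (fun A v hv => (hstep x A v).2 (.inl hv)) S hst
    · rw [← setOf_iterate_eq hstep (S := S) (by rw [h0, hS])]
      exact H
  · rintro ⟨hS, -, H⟩
    rw [← setOf_iterate_eq hstep (S := S) (by rw [h0, hS])] at H
    exact H

theorem measurableSet_preimage_activationPath [Fintype V] {X : Type*} [MeasurableSpace X]
    {g : V → X → Finset V → Prop} {step : (V → X) → Finset V → Finset V}
    (hstep : ∀ x A v, v ∈ step x A ↔ v ∈ A ∨ g v (x v) A)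
    (mg : ∀ v A, MeasurableSet {x | g v x A}) (S : Finset V) (T : ℕ)
    (A : Fin (T + 1) → Finset V) :
    MeasurableSet (activationPath step S T ⁻¹' {A}) := by
  rw [preimage_activationPath hstep]
  by_cases h : A 0 = S ∧ Monotone A
  · simp only [h.1, h.2, true_and, Set.ofPred_mem_eq]
    exact .univ_pi fun v => measurableSet_followsAt (g v) (mg v) v _ T
  · have : ∀ x : V → X, ¬ (A 0 = S ∧ Monotone A ∧ x ∈ Set.univ.pi fun v =>
      FollowsAt (g v) v (fun t => A (Fin.ofNat (T + 1) (min t T))) T) :=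
      fun x hx => h ⟨hx.1, hx.2.1⟩
    simp only [this, Set.ofPred_false, MeasurableSet.empty]

theorem measurableSet_mem_iterate [Fintype V] {X : Type*} [MeasurableSpace X]
    {g : V → X → Finset V → Prop} {step : (V → X) → Finset V → Finset V}
    (hstep : ∀ x A v, v ∈ step x A ↔ v ∈ A ∨ g v (x v) A)
    (mg : ∀ v A, MeasurableSet {x | g v x A}) (S : Finset V) (T : ℕ) (v : V) :
    MeasurableSet {x | v ∈ (step x)^[T] S} := by
  have : {x | v ∈ (step x)^[T] S} =
      ⋃ A ∈ {A : Fin (T + 1) → Finset V | v ∈ A (Fin.last T)},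
        activationPath step S T ⁻¹' {A} := by
    ext x
    simp [activationPath, Set.mem_preimage]
  rw [this]
  exact .biUnion (Set.to_countable _) fun A _ =>
    measurableSet_preimage_activationPath hstep mg S T A

theorem measure_mem_iterate_eq [Fintype V] {X Y : Type*} [MeasurableSpace X] [MeasurableSpace Y]
    (μ : V → Measure X) (ν : V → Measure Y)
    [∀ v, IsProbabilityMeasure (μ v)] [∀ v, IsProbabilityMeasure (ν v)]
    {g : V → X → Finset V → Prop} {h : V → Y → Finset V → Prop}
    (hg : ∀ v x, Monotone (g v x)) (hh : ∀ v y, Monotone (h v y))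
    (mg : ∀ v A, MeasurableSet {x | g v x A}) (mh : ∀ v A, MeasurableSet {y | h v y A})
    (hgh : ∀ v A, μ v {x | g v x A} = ν v {y | h v y A})
    {step : (V → X) → Finset V → Finset V} {step' : (V → Y) → Finset V → Finset V}
    (hstep : ∀ x A v, v ∈ step x A ↔ v ∈ A ∨ g v (x v) A)
    (hstep' : ∀ y A v, v ∈ step' y A ↔ v ∈ A ∨ h v (y v) A)
    (S : Finset V) (T : ℕ) (v : V) :
    Measure.pi μ {x | v ∈ (step x)^[T] S} = Measure.pi ν {y | v ∈ (step' y)^[T] S} := by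
  have eq : ∀ A : Fin (T + 1) → Finset V, Measure.pi μ (activationPath step S T ⁻¹' {A}) =
      Measure.pi ν (activationPath step' S T ⁻¹' {A}) := by
    intro A
    rw [preimage_activationPath hstep, preimage_activationPath hstep']
    by_cases hA : A 0 = S ∧ Monotone A
    · simp only [hA.1, hA.2, true_and, Set.ofPred_mem_eq, Measure.pi_pi]
      refine Finset.prod_congr rfl fun v _ => measure_followsAt_eq _ _ _ _ (hg v) (hh v) (mg v)
        (mh v) (hgh v) v (fun s t hst => hA.2 ?_) T
      rw [Fin.le_def]
      simp only [Fin.ofNat]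
      rw [Nat.mod_eq_of_lt (by omega), Nat.mod_eq_of_lt (by omega)]
      exact min_le_min_right T hst
    · simp only [← and_assoc, hA, false_and, Set.ofPred_false, measure_empty]
  let _ : MeasurableSpace (Fin (T + 1) → Finset V) := ⊤
  have m1 : Measurable (activationPath step S T) :=
    measurable_to_countable' fun A => measurableSet_preimage_activationPath hstep mg S T A
  have m2 : Measurable (activationPath step' S T) :=
    measurable_to_countable' fun A => measurableSet_preimage_activationPath hstep' mh S T A
  have hmap : (Measure.pi μ).map (activationPath step S T) =
      (Measure.pi ν).map (activationPath step' S T) := by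
    refine Measure.ext_of_singleton fun A => ?_
    rw [Measure.map_apply m1 trivial, Measure.map_apply m2 trivial, eq]
  have := congrArg (fun ρ => ρ {A | v ∈ A (Fin.last T)}) hmap
  beta_reduce at this
  rwa [Measure.map_apply m1 trivial, Measure.map_apply m2 trivial] at this

/-- Two progressive activation processes with independent local states and monotone triggers have
the same probability of ever activating `v`, provided that at every vertex each single set has the
same probability of triggering it. The joint law of the triggers at one vertex may differ. -/
theorem measure_exists_mem_iterate_eq [Fintype V] {X Y : Type*} [MeasurableSpace X]
    [MeasurableSpace Y]
    (μ : V → Measure X) (ν : V → Measure Y)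
    [∀ v, IsProbabilityMeasure (μ v)] [∀ v, IsProbabilityMeasure (ν v)]
    {g : V → X → Finset V → Prop} {h : V → Y → Finset V → Prop}
    (hg : ∀ v x, Monotone (g v x)) (hh : ∀ v y, Monotone (h v y))
    (mg : ∀ v A, MeasurableSet {x | g v x A}) (mh : ∀ v A, MeasurableSet {y | h v y A})
    (hgh : ∀ v A, μ v {x | g v x A} = ν v {y | h v y A})
    {step : (V → X) → Finset V → Finset V} {step' : (V → Y) → Finset V → Finset V}
    (hstep : ∀ x A v, v ∈ step x A ↔ v ∈ A ∨ g v (x v) A)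
    (hstep' : ∀ y A v, v ∈ step' y A ↔ v ∈ A ∨ h v (y v) A)
    (S : Finset V) (v : V) :
    Measure.pi μ {x | ∃ t, v ∈ (step x)^[t] S} = Measure.pi ν {y | ∃ t, v ∈ (step' y)^[t] S} := by
  rw [Set.ofPred_exists, Set.ofPred_exists, Monotone.measure_iUnion, Monotone.measure_iUnion]
  · exact iSup_congr fun T =>
      measure_mem_iterate_eq μ ν hg hh mg mh hgh hstep hstep' S T v
  · exact fun s t hst x hx =>
      monotone_of_iterate (fun A w hw => (hstep' x A w).2 (.inl hw)) S hst hx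
  · exact fun s t hst x hx =>
      monotone_of_iterate (fun A w hw => (hstep x A w).2 (.inl hw)) S hst hx

theorem exists_mem_iterate_iff_reflTransGen {step : Finset V → Finset V} {r : V → V → Prop}
    (hstep : ∀ A v, v ∈ step A ↔ v ∈ A ∨ ∃ u ∈ A, r u v) (s v : V) :
    (∃ t, v ∈ step^[t] {s}) ↔ Relation.ReflTransGen r s v := by
  constructor
  · rintro ⟨t, ht⟩
    induction t generalizing v with
    | zero => rw [Finset.mem_singleton.1 ht]
    | succ t ih =>
      rw [Function.iterate_succ_apply', hstep] at ht
      obtain ht | ⟨u, hu, huv⟩ := ht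
      · exact ih v ht
      · exact (ih u hu).tail huv
  · intro h
    induction h with
    | refl => exact ⟨0, Finset.mem_singleton_self s⟩
    | @tail u w _ huw ih =>
      obtain ⟨t, ht⟩ := ih
      exact ⟨t + 1, by rw [Function.iterate_succ_apply', hstep]; exact .inr ⟨u, ht, huw⟩⟩

end Activation

/-! ### Influence as the probability of lying in a random RR set -/

section LiveEdge
variable {V : Type*} [Fintype V] [DecidableEq V]

theorem toMeasure_indepPMF {ι α : Type*} [Fintype ι] [DecidableEq ι] [Fintype α]
    [MeasurableSpace α] [DiscreteMeasurableSpace α] (p : ι → PMF α) :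
    (indepPMF p).toMeasure = Measure.pi fun i => (p i).toMeasure := by
  refine Measure.ext_of_singleton fun c => ?_
  rw [PMF.toMeasure_apply_singleton _ _ (.singleton _), Measure.pi_singleton]
  exact Finset.prod_congr rfl fun i _ =>
    (PMF.toMeasure_apply_singleton _ _ (.singleton _)).symm

/-- A vertex that was not activated in the last step has already used its chances, so that the
attempts of the newly activated vertices alone reach everything reachable. -/
theorem ICNetwork.finalActive_eq (N : ICNetwork V) (c : N.edges → Bool) (s : V) :
    N.finalActive c {s} = {v | Relation.ReflTransGen (N.Succeeds c) s v} := by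
  have inv : ∀ t, ((N.step c)^[t] ({s}, {s})).2 ⊆ ((N.step c)^[t] ({s}, {s})).1 ∧
      ∀ u ∈ ((N.step c)^[t] ({s}, {s})).1, u ∉ ((N.step c)^[t] ({s}, {s})).2 →
        ∀ v, N.Succeeds c u v → v ∈ ((N.step c)^[t] ({s}, {s})).1 := by
    intro t
    induction t with
    | zero => simp
    | succ t ih =>
      rw [Function.iterate_succ_apply']
      set x := (N.step c)^[t] ({s}, {s})
      refine ⟨Finset.subset_union_right, fun u hu hu' v huv => ?_⟩
      simp only [ICNetwork.step, Finset.mem_union, Finset.mem_filter, Finset.mem_univ,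
        true_and] at hu hu' ⊢
      have hu1 : u ∈ x.1 := hu.resolve_right hu'
      by_cases hu2 : u ∈ x.2
      · by_cases hv : v ∈ x.1
        · exact .inl hv
        · exact .inr ⟨hv, u, hu2, huv⟩
      · exact .inl (ih.2 u hu1 hu2 v huv)
  have hstep : ∀ t, ((N.step c)^[t] ({s}, {s})).1 =
      (fun A => A ∪ (by classical exact Finset.univ.filter fun v => ∃ u ∈ A, N.Succeeds c u v))^[t]
        {s} := by
    intro t
    induction t with
    | zero => rfl
    | succ t ih =>
      rw [Function.iterate_succ_apply', Function.iterate_succ_apply', ← ih]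
      ext v
      simp only [ICNetwork.step, Finset.mem_union, Finset.mem_filter, Finset.mem_univ, true_and]
      constructor
      · rintro (h | ⟨-, u, hu, huv⟩)
        · exact .inl h
        · exact .inr ⟨u, (inv t).1 hu, huv⟩
      · rintro (h | ⟨u, hu, huv⟩)
        · exact .inl h
        · by_cases hv : v ∈ ((N.step c)^[t] ({s}, {s})).1
          · exact .inl hv
          · refine .inr ⟨hv, u, ?_, huv⟩
            by_contra hu2
            exact hv ((inv t).2 u hu hu2 v huv)
  ext v
  simp only [ICNetwork.finalActive, Set.mem_ofPred_eq, hstep]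
  exact exists_mem_iterate_iff_reflTransGen (fun A v => by simp) s v

theorem ncard_eq_sum_indicator {α : Type*} [Fintype α] (A : Set α) :
    (A.ncard : ℝ) = ∑ a, A.indicator 1 a := by
  classical
  simp [Set.indicator_apply, Set.ncard_eq_toFinset_card', Set.toFinset_card]

theorem PMF.toReal_toOuterMeasure_apply {α : Type*} [Fintype α] (p : PMF α) (A : Set α) :
    (p.toOuterMeasure A).toReal = ∑ a, (p a).toReal * A.indicator 1 a := by
  rw [PMF.toOuterMeasure_apply_fintype, ENNReal.toReal_sum]
  · refine Finset.sum_congr rfl fun a _ => ?_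
    by_cases h : a ∈ A <;> simp [h]
  · intro a _
    by_cases h : a ∈ A <;> simp [h, p.apply_ne_top]

theorem ICNetwork.spread_singleton (N : ICNetwork V) (u : V) :
    N.spread {u} =
      ∑ v, (N.liveEdges.toOuterMeasure {live | Relation.ReflTransGen live u v}).toReal := by
  simp only [ICNetwork.spread, ICNetwork.finalActive_eq, ncard_eq_sum_indicator,
    Finset.mul_sum, ICNetwork.liveEdges, PMF.toOuterMeasure_map_apply,
    PMF.toReal_toOuterMeasure_apply]
  rw [Finset.sum_comm]
  rfl

/-- The threshold rule and the live-edge rule trigger `v` with the same probability, for each set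
`A` of active vertices. -/
theorem LTNetwork.measure_threshold_le (N : LTNetwork V) (v : V) (A : Finset V) :
    ((volume : Measure ℝ).restrict (Set.Icc 0 1))
      {x | x ≤ ∑ u ∈ N.inNbrs v ∩ A, (N.prob u v : ℝ)} =
      (N.pickPMF v).toOuterMeasure {o | ∃ u ∈ A, o = some u} := by
  classical
  have hle : ∑ u ∈ N.inNbrs v ∩ A, N.prob u v ≤ 1 :=
    (Finset.sum_le_sum_of_subset Finset.inter_subset_left).trans (N.sum_prob_le_one v)
  have hm : MeasurableSet {x : ℝ | x ≤ ∑ u ∈ N.inNbrs v ∩ A, (N.prob u v : ℝ)} :=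
    measurableSet_Iic
  rw [Measure.restrict_apply hm]
  -- If no in-neighbour in `A` has positive weight, this is the null event `{0}`.
  have e : {x : ℝ | x ≤ ∑ u ∈ N.inNbrs v ∩ A, (N.prob u v : ℝ)} ∩ Set.Icc 0 1 =
      Set.Icc 0 ((∑ u ∈ N.inNbrs v ∩ A, N.prob u v : ℝ≥0) : ℝ) := by
    ext x
    have : ((∑ u ∈ N.inNbrs v ∩ A, N.prob u v : ℝ≥0) : ℝ) ≤ 1 := by exact_mod_cast hle
    push_cast at this ⊢
    simp only [Set.mem_inter_iff, Set.mem_ofPred_eq, Set.mem_Icc]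
    exact ⟨fun h => ⟨h.2.1, h.1⟩, fun h => ⟨h.2, h.1, h.2.trans this⟩⟩
  rw [e, Real.volume_Icc, sub_zero, ENNReal.ofReal_coe_nnreal, PMF.toOuterMeasure_apply_fintype,
    Fintype.sum_option]
  simp only [Set.indicator_apply, Set.mem_ofPred_eq, Option.some.injEq, exists_eq_right',
    reduceCtorEq, and_false, exists_false, if_false, zero_add]
  rw [ENNReal.ofNNReal_finsetSum, Finset.inter_comm, ← Finset.sum_ite_mem,
    ← Finset.sum_ite_mem_eq A]
  simp only [LTNetwork.pickPMF, PMF.ofFintype_apply]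

instance isProbabilityMeasure_restrict_Icc_zero_one :
    IsProbabilityMeasure ((volume : Measure ℝ).restrict (Set.Icc 0 1)) :=
  ⟨by simp⟩

/-- The live-edge description of the linear threshold model, for a single seed. -/
theorem LTNetwork.measure_finalActive (N : LTNetwork V) (u v : V) :
    Measure.pi (fun _ : V => (volume : Measure ℝ).restrict (Set.Icc 0 1))
        {thr | v ∈ N.finalActive thr {u}} =
      N.liveEdges.toOuterMeasure {live | Relation.ReflTransGen live u v} := by
  classical
  let _ : MeasurableSpace (Option V) := ⊤
  have hstep' : ∀ (c : V → Option V) (A : Finset V) v,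
      v ∈ A ∪ Finset.univ.filter (fun v => ∃ u ∈ A, c v = some u) ↔
        v ∈ A ∨ ∃ u ∈ A, c v = some u := fun c A v => by simp
  have h := measure_exists_mem_iterate_eq
    (fun _ : V => (volume : Measure ℝ).restrict (Set.Icc 0 1))
    (fun v => (N.pickPMF v).toMeasure)
    (g := fun v x A => x ≤ ∑ u ∈ N.inNbrs v ∩ A, (N.prob u v : ℝ))
    (h := fun v o A => ∃ u ∈ A, o = some u)
    (step := N.step)
    (step' := fun c A => A ∪ Finset.univ.filter (fun v => ∃ u ∈ A, c v = some u))
    (fun v x A B hAB hx => hx.trans (Finset.sum_le_sum_of_subset_of_nonneg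
      (Finset.inter_subset_inter_left hAB) fun _ _ _ => NNReal.coe_nonneg _))
    (fun v o A B hAB ⟨u, hu, ho⟩ => ⟨u, hAB hu, ho⟩)
    (fun v A => measurableSet_Iic) (fun v A => .of_discrete)
    (fun v A => by
      rw [PMF.toMeasure_apply_eq_toOuterMeasure_apply _ .of_discrete, N.measure_threshold_le v A])
    (fun x A v => by simp [LTNetwork.step]) hstep' {u} v
  refine h.trans ?_
  rw [← toMeasure_indepPMF, PMF.toMeasure_apply_eq_toOuterMeasure_apply _ .of_discrete,
    LTNetwork.liveEdges, PMF.toOuterMeasure_map_apply]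
  congr 1
  ext c
  exact exists_mem_iterate_iff_reflTransGen (hstep' c) u v

theorem LTNetwork.spread_singleton (N : LTNetwork V) (u : V) :
    N.spread {u} =
      ∑ v, (N.liveEdges.toOuterMeasure {live | Relation.ReflTransGen live u v}).toReal := by
  have hm : ∀ v, MeasurableSet {thr | v ∈ N.finalActive thr {u}} := by
    intro v
    have e : {thr | v ∈ N.finalActive thr {u}} = ⋃ t, {thr | v ∈ (N.step thr)^[t] {u}} := by
      ext thr
      simp [LTNetwork.finalActive]
    rw [e]
    exact .iUnion fun t => measurableSet_mem_iterate
      (g := fun v x A => x ≤ ∑ u ∈ N.inNbrs v ∩ A, (N.prob u v : ℝ))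
      (fun x A v => by simp [LTNetwork.step]) (fun v A => measurableSet_Iic) {u} t v
  have hi : ∀ v (thr : V → ℝ), (N.finalActive thr {u}).indicator (1 : V → ℝ) v =
      {thr | v ∈ N.finalActive thr {u}}.indicator (fun _ => (1 : ℝ)) thr := fun v thr => rfl
  simp only [LTNetwork.spread, ncard_eq_sum_indicator, hi]
  rw [integral_finsetSum _ fun v _ => (integrable_const _).indicator (hm v)]
  refine Finset.sum_congr rfl fun v _ => ?_
  rw [← N.measure_finalActive u v]
  exact integral_indicator_one (hm v)

theorem InfluenceNetwork.influence_eq_sum (G : InfluenceNetwork V) (u : V) :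
    G.influence u =
      ∑ v, (G.liveEdges.toOuterMeasure {live | Relation.ReflTransGen live u v}).toReal := by
  cases G with
  | linearThreshold N => exact N.spread_singleton u
  | independentCascade N => exact N.spread_singleton u

/-- The influence of `u` is `n` times the probability that a random RR set contains `u`. -/
theorem InfluenceNetwork.influence_eq [Nonempty V] (G : InfluenceNetwork V) (u : V) :
    G.influence u = Fintype.card V * G.rrSet.toMeasure.real {s | u ∈ s} := by
  have hn : (Fintype.card V : ℝ) ≠ 0 := by exact_mod_cast Fintype.card_ne_zero
  rw [Measure.real, PMF.toMeasure_apply_eq_toOuterMeasure_apply _ (measurableSet_setOfPred.2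
    (measurable_set_mem u)), InfluenceNetwork.rrSet, PMF.toOuterMeasure_bind_apply, tsum_fintype,
    ENNReal.toReal_sum, G.influence_eq_sum, Finset.mul_sum]
  · refine Finset.sum_congr rfl fun v _ => ?_
    rw [PMF.toOuterMeasure_map_apply, ENNReal.toReal_mul, PMF.uniformOfFintype_apply,
      ENNReal.toReal_inv, ENNReal.toReal_natCast, mul_inv_cancel_left₀ hn]
    rfl
  · exact fun v _ => ENNReal.mul_ne_top (PMF.apply_ne_top _ _)
      (ne_top_of_le_ne_top ENNReal.one_ne_top
        ((OuterMeasure.mono _ (Set.subset_univ _)).trans_eq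
          ((PMF.toOuterMeasure_apply_eq_one_iff _ _).2 (Set.subset_univ _))))

theorem InfluenceNetwork.one_le_influence (G : InfluenceNetwork V) (u : V) :
    1 ≤ G.influence u := by
  rw [G.influence_eq_sum]
  have h : (G.liveEdges.toOuterMeasure {live | Relation.ReflTransGen live u u}).toReal = 1 := by
    rw [(PMF.toOuterMeasure_apply_eq_one_iff _ {live | Relation.ReflTransGen live u u}).2
      fun live _ => Relation.ReflTransGen.refl]
    rfl
  rw [← h]
  exact Finset.single_le_sum (f := fun v =>
    (G.liveEdges.toOuterMeasure {live | Relation.ReflTransGen live u v}).toReal)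
    (fun _ _ => ENNReal.toReal_nonneg) (Finset.mem_univ u)

end LiveEdge

/-! ### Chernoff bounds for sums of independent indicators -/

section Chernoff

theorem mgf_le_of_zero_or_one {Ω : Type*} [MeasurableSpace Ω] {μ : Measure Ω}
    [IsProbabilityMeasure μ] {X : Ω → ℝ} (hX : AEMeasurable X μ) (h01 : ∀ ω, X ω = 0 ∨ X ω = 1)
    (s : ℝ) : mgf X μ s ≤ Real.exp (μ[X] * (Real.exp s - 1)) := by
  have hint : Integrable X μ := .of_bound hX.aestronglyMeasurable 1
    (.of_forall fun ω => by rcases h01 ω with h | h <;> simp [h])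
  have h : ∀ ω, Real.exp (s * X ω) = 1 + X ω * (Real.exp s - 1) := fun ω => by
    rcases h01 ω with h | h <;> simp [h]
  unfold mgf
  simp_rw [h]
  rw [integral_add (integrable_const _) (hint.mul_const _), integral_mul_const]
  simp only [integral_const, probReal_univ, smul_eq_mul, mul_one]
  linarith [Real.add_one_le_exp (μ[X] * (Real.exp s - 1))]

theorem mgf_sum_le_of_zero_or_one {Ω : Type*} [MeasurableSpace Ω] {μ : Measure Ω}
    [IsProbabilityMeasure μ] {X : ℕ → Ω → ℝ} (hX : ∀ i, AEMeasurable (X i) μ)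
    (h01 : ∀ i ω, X i ω = 0 ∨ X i ω = 1) (hind : iIndepFun X μ) {q : ℝ} (hq : ∀ i, μ[X i] = q)
    (N : ℕ) (s : ℝ) :
    mgf (∑ i ∈ Finset.range N, X i) μ s ≤ Real.exp (N * q * (Real.exp s - 1)) := by
  rw [hind.mgf_sum₀ hX]
  calc ∏ i ∈ Finset.range N, mgf (X i) μ s
      ≤ ∏ i ∈ Finset.range N, Real.exp (q * (Real.exp s - 1)) :=
        Finset.prod_le_prod (fun _ _ => mgf_nonneg) fun i _ => by
          rw [← hq i]; exact mgf_le_of_zero_or_one (hX i) (h01 i) s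
    _ = _ := by rw [Finset.prod_const, Finset.card_range, ← Real.exp_nat_mul, mul_assoc]

theorem integrable_exp_mul_sum_of_zero_or_one {Ω : Type*} [MeasurableSpace Ω] {μ : Measure Ω}
    [IsProbabilityMeasure μ] {X : ℕ → Ω → ℝ} (hX : ∀ i, AEMeasurable (X i) μ)
    (h01 : ∀ i ω, X i ω = 0 ∨ X i ω = 1) (N : ℕ) (s : ℝ) :
    Integrable (fun ω => Real.exp (s * (∑ i ∈ Finset.range N, X i) ω)) μ := by
  refine .of_bound (C := Real.exp (|s| * N)) ?_ (.of_forall fun ω => ?_)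
  · exact (Real.measurable_exp.comp_aemeasurable
      ((Finset.aemeasurable_sum _ fun i _ => hX i).const_mul s)).aestronglyMeasurable
  · rw [Real.norm_eq_abs, Real.abs_exp, Real.exp_le_exp, Finset.sum_apply]
    refine (le_abs_self _).trans ?_
    rw [abs_mul]
    refine mul_le_mul_of_nonneg_left ((Finset.abs_sum_le_sum_abs _ _).trans ?_) (abs_nonneg s)
    calc ∑ i ∈ Finset.range N, |X i ω| ≤ ∑ i ∈ Finset.range N, (1 : ℝ) :=
          Finset.sum_le_sum fun i _ => by rcases h01 i ω with h | h <;> simp [h]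
      _ = N := by simp

/-- Upper Chernoff bound, with a deviation `ε * m` measured relative to an upper bound `m` of the
mean `N * q` instead of the mean itself. -/
theorem measure_sum_ge_le {Ω : Type*} [MeasurableSpace Ω] {μ : Measure Ω}
    [IsProbabilityMeasure μ] {X : ℕ → Ω → ℝ} (hX : ∀ i, AEMeasurable (X i) μ)
    (h01 : ∀ i ω, X i ω = 0 ∨ X i ω = 1) (hind : iIndepFun X μ) {q : ℝ} (hq : ∀ i, μ[X i] = q)
    {N : ℕ} {ε m a : ℝ} (hε : 0 ≤ ε) (hN : N * q ≤ m) (ha : N * q + ε * m ≤ a) :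
    μ.real {ω | a ≤ ∑ i ∈ Finset.range N, X i ω} ≤ Real.exp (-(ε ^ 2 * m / (2 + ε))) := by
  have hm : 0 ≤ m := by
    refine le_trans (mul_nonneg N.cast_nonneg ?_) hN
    rw [← hq 0]
    exact integral_nonneg fun ω => by rcases h01 0 ω with h | h <;> simp [h]
  -- The optimal exponent for the deviation `ε * m` when the mean equals `m`.
  set s := Real.log (1 + ε)
  have hes : Real.exp s = 1 + ε := Real.exp_log (by linarith)
  have hs0 : 0 ≤ s := Real.log_nonneg (by linarith)
  have hsε : s ≤ ε := by
    have := Real.log_le_sub_one_of_pos (show 0 < 1 + ε by linarith)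
    linarith
  have hsl : 2 * ε / (ε + 2) ≤ s := Real.le_log_one_add_of_nonneg hε
  have h := measure_ge_le_exp_mul_mgf (X := ∑ i ∈ Finset.range N, X i) (μ := μ) a hs0
    (integrable_exp_mul_sum_of_zero_or_one hX h01 N s)
  simp only [Finset.sum_apply] at h
  refine h.trans ?_
  refine (mul_le_mul_of_nonneg_left (mgf_sum_le_of_zero_or_one hX h01 hind hq N s)
    (Real.exp_nonneg _)).trans ?_
  rw [← Real.exp_add, Real.exp_le_exp, hes]
  have h1 : s * (N * q + ε * m) ≤ s * a := mul_le_mul_of_nonneg_left ha hs0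
  have h2 : N * q * (ε - s) ≤ m * (ε - s) := mul_le_mul_of_nonneg_right hN (by linarith)
  have h3 : m * (1 + ε) * (2 * ε / (ε + 2)) ≤ m * (1 + ε) * s :=
    mul_le_mul_of_nonneg_left hsl (by positivity)
  have h4 : m * (1 + ε) * (2 * ε / (ε + 2)) - m * ε = ε ^ 2 * m / (2 + ε) := by
    field_simp; ring
  nlinarith

/-- Lower Chernoff bound, relative to a lower bound `m` of the mean `N * q`. -/
theorem measure_sum_le_le {Ω : Type*} [MeasurableSpace Ω] {μ : Measure Ω}
    [IsProbabilityMeasure μ] {X : ℕ → Ω → ℝ} (hX : ∀ i, AEMeasurable (X i) μ)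
    (h01 : ∀ i ω, X i ω = 0 ∨ X i ω = 1) (hind : iIndepFun X μ) {q : ℝ} (hq : ∀ i, μ[X i] = q)
    {N : ℕ} {ε m a : ℝ} (hε : 0 ≤ ε) (hN : m ≤ N * q) (ha : a ≤ (1 - ε) * m) (hm : 0 ≤ m) :
    μ.real {ω | ∑ i ∈ Finset.range N, X i ω ≤ a} ≤ Real.exp (-(ε ^ 2 * m / 2)) := by
  -- The exponent `-ε` is close enough to the optimal `log (1 - ε)`.
  have h := measure_le_le_exp_mul_mgf (X := ∑ i ∈ Finset.range N, X i) (μ := μ) a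
    (neg_nonpos.2 hε) (integrable_exp_mul_sum_of_zero_or_one hX h01 N (-ε))
  simp only [Finset.sum_apply] at h
  refine h.trans ?_
  refine (mul_le_mul_of_nonneg_left (mgf_sum_le_of_zero_or_one hX h01 hind hq N (-ε))
    (Real.exp_nonneg _)).trans ?_
  rw [← Real.exp_add, Real.exp_le_exp]
  have hexp : Real.exp (-ε) ≤ 1 - ε + ε ^ 2 / 2 := by
    have h1 := Real.quadratic_le_exp_of_nonneg hε
    have h2 : Real.exp (-ε) * Real.exp ε = 1 := by rw [← Real.exp_add]; simp
    have h3 := Real.exp_pos (-ε)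
    have h4 : 0 < 1 - ε + ε ^ 2 / 2 := by nlinarith [sq_nonneg (ε - 1)]
    have h5 := mul_le_mul_of_nonneg_left h1 h4.le
    by_contra! h6
    have := mul_lt_mul_of_pos_right h6 (Real.exp_pos ε)
    nlinarith [sq_nonneg (ε ^ 2)]
  have hle : Real.exp (-ε) - 1 ≤ 0 := by
    have := Real.exp_le_one_iff.2 (neg_nonpos.2 hε); linarith
  have h1 : N * q * (Real.exp (-ε) - 1) ≤ m * (Real.exp (-ε) - 1) :=
    mul_le_mul_of_nonpos_right hN hle
  have h2 : m * (Real.exp (-ε) - 1) ≤ m * (-ε + ε ^ 2 / 2) :=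
    mul_le_mul_of_nonneg_left (by linarith) hm
  have h3 : ε * a ≤ ε * ((1 - ε) * m) := mul_le_mul_of_nonneg_left ha hε
  nlinarith

end Chernoff

/-! ### The `k`-th largest value -/

section KthLargest
variable {V : Type*} [Fintype V] {α : Type*} [ConditionallyCompleteLinearOrder α]

/-- The supremum that defines the `k`-th largest value is attained, so that at least `k` vertices
have a value at least as large. -/
theorem isGreatest_kthLargest (f : V → α) {k : ℕ} (hk : 1 ≤ k) (hkn : k ≤ Fintype.card V) :
    IsGreatest {t | k ≤ {v | t ≤ f v}.ncard} (kthLargest f k) := by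
  have : Nonempty V := Fintype.card_pos_iff.1 (by omega)
  have lift : ∀ t, k ≤ {v | t ≤ f v}.ncard →
      ∃ w, t ≤ f w ∧ k ≤ {v | f w ≤ f v}.ncard := by
    intro t ht
    obtain ⟨w, hw, hmin⟩ := Set.exists_min_image {v | t ≤ f v} f (Set.toFinite _)
      ((Set.ncard_pos (Set.toFinite _)).1 (by omega))
    exact ⟨w, hw, ht.trans (Set.ncard_le_ncard (fun v hv => hmin v hv) (Set.toFinite _))⟩
  obtain ⟨w₀, hw₀⟩ := Finite.exists_min f
  have hne : {w | k ≤ {v | f w ≤ f v}.ncard}.Nonempty := ⟨w₀, by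
    have : {v | f w₀ ≤ f v} = Set.univ := Set.eq_univ_of_forall hw₀
    rw [Set.mem_ofPred_eq, this, Set.ncard_univ, Nat.card_eq_fintype_card]
    exact hkn⟩
  obtain ⟨w, hw, hmax⟩ := Set.exists_max_image _ f (Set.toFinite _) hne
  have hg : IsGreatest {t | k ≤ {v | t ≤ f v}.ncard} (f w) := ⟨hw, fun t ht => by
    obtain ⟨w', h1, h2⟩ := lift t ht
    exact h1.trans (hmax w' h2)⟩
  rw [kthLargest, hg.csSup_eq]
  exact hg

theorem ncard_kthLargest_lt (f : V → α) {k : ℕ} (hk : 1 ≤ k) (hkn : k ≤ Fintype.card V) :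
    {v | kthLargest f k < f v}.ncard < k := by
  by_contra! h
  obtain ⟨w, hw, hmin⟩ := Set.exists_min_image {v | kthLargest f k < f v} f (Set.toFinite _)
    ((Set.ncard_pos (Set.toFinite _)).1 (by omega))
  have h2 : k ≤ {v | f w ≤ f v}.ncard :=
    h.trans (Set.ncard_le_ncard (fun v hv => hmin v hv) (Set.toFinite _))
  exact absurd ((isGreatest_kthLargest f hk hkn).2 h2) (not_le_of_gt hw)

end KthLargest

/-! ### Degrees and the deterministic part of the guarantee -/

section Degree
variable {V : Type*}

theorem degree_mono (R : ℕ → Set V) (u : V) : Monotone fun m => degree R m u := fun _ _ h => by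
  classical
  exact Finset.card_le_card (Finset.filter_subset_filter _ (Finset.range_mono h))

theorem degree_eq_sum (R : ℕ → Set V) (m : ℕ) (u : V) :
    (degree R m u : ℝ) = ∑ i ∈ Finset.range m, {s : Set V | u ∈ s}.indicator 1 (R i) := by
  classical
  simp [degree, Set.indicator_apply]

/-- The deterministic part of the guarantee. By `h₁`, a sample of fewer than `N` sets gives degree
`m` only to vertices of `f`-value above the `k`-th largest, of which there are fewer than `k`; hence
`N ≤ M`. By `h₃`, a sample of at least `U` sets gives a degree above `m` to at least `k` vertices;
hence `M ≤ U`. As degrees grow with the sample, `h₂` and `h₄` then decide who is in the answer. -/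
theorem queryAnswer_spec [Fintype V] {R₁ R₂ : ℕ → Set V} {f : V → ℝ} {k m M N U : ℕ} {ε b : ℝ}
    (hk : 1 ≤ k) (hkn : k ≤ Fintype.card V) (hM : kthLargest (degree R₁ M) k = m)
    (h₁ : ∀ u, f u ≤ kthLargest f k → degree R₁ (N - 1) u < m)
    (h₂ : ∀ v, kthLargest f k ≤ f v → (1 - ε) / (1 + ε) * m < degree R₂ N v)
    (h₃ : ∀ v, kthLargest f k ≤ f v → m < degree R₁ U v)
    (h₄ : ∀ u, f u < b → degree R₂ U u < (1 - ε) / (1 + ε) * m) :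
    (∀ v, kthLargest f k ≤ f v → v ∈ queryAnswer ε k R₁ R₂ M) ∧
      ∀ u ∈ queryAnswer ε k R₁ R₂ M, b ≤ f u := by
  have hNM : N ≤ M := by
    by_contra! hlt
    obtain ⟨u, hu, hu'⟩ := Set.exists_mem_notMem_of_ncard_lt_ncard
      ((ncard_kthLargest_lt f hk hkn).trans_le (isGreatest_kthLargest (degree R₁ M) hk hkn).1)
    rw [Set.mem_ofPred_eq, hM] at hu
    exact absurd (hu.trans (degree_mono R₁ u (show M ≤ N - 1 by omega)))
      (not_le_of_gt (h₁ u (not_lt.1 hu')))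
  have hMU : M ≤ U := by
    by_contra! hlt
    obtain ⟨v, hv, hv'⟩ := Set.exists_mem_notMem_of_ncard_lt_ncard
      ((ncard_kthLargest_lt (degree R₁ M) hk hkn).trans_le (isGreatest_kthLargest f hk hkn).1)
    rw [Set.mem_ofPred_eq, hM] at hv'
    exact hv' ((h₃ v hv).trans_le (degree_mono R₁ v hlt.le))
  constructor
  · intro v hv
    rw [queryAnswer, Set.mem_ofPred_eq, hM]
    exact (h₂ v hv).le.trans (Nat.cast_le.2 (degree_mono R₂ v hNM))
  · intro u hu
    rw [queryAnswer, Set.mem_ofPred_eq, hM] at hu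
    by_contra! hlt
    exact absurd (hu.trans (Nat.cast_le.2 (degree_mono R₂ u hMU))) (not_le_of_gt (h₄ u hlt))

end Degree

/-! ### Concentration of degrees -/

section Sampling
variable {V : Type*} {Ω : Type*} [MeasurableSpace Ω] {μ : Measure Ω} {ρ : Measure (Set V)}
  {R : ℕ → Ω → Set V}

theorem measurable_indicator_mem (u : V) :
    Measurable ({s : Set V | u ∈ s}.indicator (1 : Set V → ℝ)) :=
  measurable_one.indicator (measurableSet_setOfPred.2 (measurable_set_mem u))

theorem integral_indicator_mem (hR : ∀ i, HasLaw (R i) ρ μ) (u : V) (i : ℕ) :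
    ∫ ω, {s : Set V | u ∈ s}.indicator (1 : Set V → ℝ) (R i ω) ∂μ = ρ.real {s | u ∈ s} := by
  rw [← integral_map (hR i).aemeasurable (measurable_indicator_mem u).aestronglyMeasurable,
    (hR i).map_eq]
  exact integral_indicator_one (measurableSet_setOfPred.2 (measurable_set_mem u))

theorem indicator_mem_zero_or_one (s : Set V) (u : V) :
    {s : Set V | u ∈ s}.indicator (1 : Set V → ℝ) s = 0 ∨
      {s : Set V | u ∈ s}.indicator (1 : Set V → ℝ) s = 1 := by
  by_cases h : u ∈ s <;> simp [h]

theorem measure_degree_ge_le [IsProbabilityMeasure μ]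
    (hR : ∀ i, HasLaw (R i) ρ μ) (hind : iIndepFun R μ)
    (u : V) {N : ℕ} {ε m a : ℝ} (hε : 0 ≤ ε) (hN : N * ρ.real {s | u ∈ s} ≤ m)
    (ha : N * ρ.real {s | u ∈ s} + ε * m ≤ a) :
    μ.real {ω | a ≤ (degree (fun i => R i ω) N u : ℝ)} ≤ Real.exp (-(ε ^ 2 * m / (2 + ε))) := by
  simp only [degree_eq_sum]
  exact measure_sum_ge_le
    (fun i => (measurable_indicator_mem u).comp_aemeasurable (hR i).aemeasurable)
    (fun i ω => indicator_mem_zero_or_one (R i ω) u)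
    (hind.comp (fun _ => {s : Set V | u ∈ s}.indicator 1) fun _ => measurable_indicator_mem u)
    (integral_indicator_mem hR u) hε hN ha

theorem measure_degree_le_le [IsProbabilityMeasure μ]
    (hR : ∀ i, HasLaw (R i) ρ μ) (hind : iIndepFun R μ)
    (u : V) {N : ℕ} {ε m a : ℝ} (hε : 0 ≤ ε) (hN : m ≤ N * ρ.real {s | u ∈ s}) (ha : a ≤ (1 - ε) * m)
    (hm : 0 ≤ m) :
    μ.real {ω | (degree (fun i => R i ω) N u : ℝ) ≤ a} ≤ Real.exp (-(ε ^ 2 * m / 2)) := by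
  simp only [degree_eq_sum]
  exact measure_sum_le_le
    (fun i => (measurable_indicator_mem u).comp_aemeasurable (hR i).aemeasurable)
    (fun i ω => indicator_mem_zero_or_one (R i ω) u)
    (hind.comp (fun _ => {s : Set V | u ∈ s}.indicator 1) fun _ => measurable_indicator_mem u)
    (integral_indicator_mem hR u) hε hN ha hm

theorem measureReal_setOf_and_le {P : Prop} {A : Set Ω} {c : ℝ} (hc : 0 ≤ c)
    (h : P → μ.real A ≤ c) : μ.real {ω | P ∧ ω ∈ A} ≤ c := by
  by_cases hP : P
  · simpa [hP] using h hP
  · simpa [hP] using hc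

/-- Union bound over the vertices; none of the events has to be measurable. -/
theorem one_sub_le_measureReal_of_forall [Fintype V] [IsProbabilityMeasure μ]
    {A : V → Set Ω} {E : Set Ω} {c : ℝ}
    (hA : ∀ v, μ.real (A v) ≤ c) (hE : ∀ᵐ ω ∂μ, (∀ v, ω ∉ A v) → ω ∈ E) :
    1 - Fintype.card V * c ≤ μ.real E := by
  have h1 : μ.real (E ∪ ⋃ v, A v) = 1 := by
    have : (E ∪ ⋃ v, A v : Set Ω) =ᵐ[μ] Set.univ := by
      rw [ae_eq_univ]
      refine measure_mono_null (fun ω hω => ?_) hE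
      simp only [Set.mem_compl_iff, Set.mem_union, Set.mem_iUnion, not_or, not_exists] at hω
      exact fun h => hω.1 (h hω.2)
    rw [measureReal_congr this, probReal_univ]
  have h2 : μ.real (⋃ v, A v) ≤ Fintype.card V * c := by
    refine (measureReal_iUnion_fintype_le A).trans ?_
    simpa using Finset.sum_le_card_nsmul Finset.univ (fun v => μ.real (A v)) c fun v _ => hA v
  linarith [measureReal_union_le (μ := μ) E (⋃ v, A v)]

end Sampling

/-! ### Arithmetic of the constants -/

section Constants

theorem le_four_mul_exp_one_sub_two : (2.87 : ℝ) ≤ 4 * (Real.exp 1 - 2) := by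
  linarith [Real.exp_one_gt_d9]

/-- A mean of at least `Υ(ε, δ)` makes each Chernoff bound at most `δ / 2`, since
`4 (e - 2) > 2.87` exceeds the denominators `2` and `2 + ε ≤ 7 / 3` in the exponents. -/
theorem exp_neg_le_of_upsilon_le {ε δ m d : ℝ} (hε : 0 < ε) (hδ : 0 < δ) (hδ' : δ ≤ 2)
    (hd : 0 < d) (hd' : d ≤ 7 / 3) (hm : upsilon ε δ ≤ m) :
    Real.exp (-(ε ^ 2 * m / d)) ≤ δ / 2 := by
  have hlog : 0 ≤ Real.log (2 / δ) := Real.log_nonneg ((one_le_div hδ).2 hδ')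
  have h1 : d * Real.log (2 / δ) ≤ ε ^ 2 * m := by
    calc d * Real.log (2 / δ) ≤ 4 * (Real.exp 1 - 2) * Real.log (2 / δ) :=
          mul_le_mul_of_nonneg_right (by linarith [le_four_mul_exp_one_sub_two]) hlog
      _ = ε ^ 2 * upsilon ε δ := by unfold upsilon; field_simp
      _ ≤ ε ^ 2 * m := mul_le_mul_of_nonneg_left hm (sq_nonneg ε)
  have h2 : Real.log (2 / δ) ≤ ε ^ 2 * m / d := (le_div_iff₀ hd).2 (by linarith)
  calc Real.exp (-(ε ^ 2 * m / d)) ≤ Real.exp (-Real.log (2 / δ)) :=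
        Real.exp_le_exp.2 (neg_le_neg h2)
    _ = δ / 2 := by rw [← Real.log_inv, Real.exp_log (by positivity), inv_div]

theorem two_le_four_mul_log {x : ℝ} (hx : 8 ≤ x) :
    2 ≤ 4 * (Real.exp 1 - 2) * Real.log x := by
  have h1 : (1 : ℝ) ≤ Real.log x := by
    rw [Real.le_log_iff_exp_le (by linarith)]
    linarith [Real.exp_one_lt_d9]
  nlinarith [le_four_mul_exp_one_sub_two]

theorem one_sub_le_trackingFactor {ε B : ℝ} (hε : 0 < ε) (hε' : ε ≤ 1 / 3) (hB : 2 ≤ B) :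
    1 - 61 / 15 * ε ≤ (1 - ε ^ 2 / B) * ((1 - ε) ^ 2 / (1 + ε)) - ε := by
  have h1 : ε ^ 2 / B ≤ ε ^ 2 / 2 := div_le_div_of_nonneg_left (sq_nonneg ε) two_pos hB
  have h2 : 1 - 3 * ε + 3 * ε ^ 2 ≤ (1 - ε) ^ 2 / (1 + ε) := by
    rw [le_div_iff₀ (by linarith)]
    nlinarith [sq_nonneg ε, mul_nonneg (sq_nonneg ε) (show 0 ≤ 1 / 3 - ε by linarith)]
  have h3 : (1 - ε ^ 2 / 2) * (1 - 3 * ε + 3 * ε ^ 2) ≤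
      (1 - ε ^ 2 / B) * ((1 - ε) ^ 2 / (1 + ε)) :=
    mul_le_mul (by linarith) h2 (by nlinarith) (by nlinarith)
  nlinarith [mul_nonneg (sq_nonneg ε) hε.le, mul_nonneg (sq_nonneg ε) (sq_nonneg ε),
    mul_nonneg (sq_nonneg ε) (show 0 ≤ 1 / 3 - ε by linarith)]

theorem trackingFactor_add_le_one {ε x : ℝ} (hε : 0 < ε) (hε' : ε < 1) (hx : 0 ≤ x) :
    (1 - x) * ((1 - ε) ^ 2 / (1 + ε)) ≤ 1 := by
  have h1 : (1 - ε) ^ 2 / (1 + ε) ≤ 1 := by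
    rw [div_le_one (by linarith)]; nlinarith
  have h2 : 0 ≤ (1 - ε) ^ 2 / (1 + ε) := by positivity
  nlinarith

/-- Rounding the sample size `m / ((1 - ε) p)` up costs at most the factor `1 - x`, if `x m ≥ 1`. -/
theorem ceil_mul_le {ε x p m : ℝ} (hε : 0 < ε) (hε' : ε < 1) (hx : x ≤ 1)
    (hp : 0 < p) (hp' : p ≤ 1) (hm : 0 ≤ m) (hxm : 1 ≤ x * m) :
    (1 - x) * ((1 - ε) * (⌈m / ((1 - ε) * p)⌉₊ * p)) ≤ m := by
  have hε1 : 0 < 1 - ε := by linarith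
  have hq : 0 < (1 - ε) * p := by positivity
  have h1 : (1 - ε) * (⌈m / ((1 - ε) * p)⌉₊ * p) ≤ m + 1 := by
    calc (1 - ε) * (⌈m / ((1 - ε) * p)⌉₊ * p) = ⌈m / ((1 - ε) * p)⌉₊ * ((1 - ε) * p) := by ring
      _ ≤ (m / ((1 - ε) * p) + 1) * ((1 - ε) * p) :=
        mul_le_mul_of_nonneg_right (Nat.ceil_lt_add_one (by positivity)).le hq.le
      _ = m + (1 - ε) * p := by rw [add_mul, div_mul_cancel₀ _ hq.ne', one_mul]
      _ ≤ m + 1 := by nlinarith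
  nlinarith [mul_le_mul_of_nonneg_left h1 (show 0 ≤ 1 - x by linarith)]

theorem mul_trackingFactor_add_le {ε x p m : ℝ} (hε : 0 < ε) (hε' : ε < 1) (hx : x ≤ 1)
    (hp : 0 < p) (hp' : p ≤ 1) (hm : 0 ≤ m) (hxm : 1 ≤ x * m) :
    ⌈m / ((1 - ε) * p)⌉₊ * (((1 - x) * ((1 - ε) ^ 2 / (1 + ε)) - ε) * p) +
      ε * (⌈m / ((1 - ε) * p)⌉₊ * p) ≤ (1 - ε) / (1 + ε) * m := by
  calc _ = (1 - ε) / (1 + ε) * ((1 - x) * ((1 - ε) * (⌈m / ((1 - ε) * p)⌉₊ * p))) := by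
        field_simp; ring
    _ ≤ (1 - ε) / (1 + ε) * m :=
      mul_le_mul_of_nonneg_left (ceil_mul_le hε hε' hx hp hp' hm hxm)
        (div_nonneg (by linarith) (by linarith))

end Constants

/-! ### The top-`k` guarantee -/

theorem theorem2 {V : Type*} [Fintype V] [DecidableEq V] [Nonempty V]
    (G : InfluenceNetwork V)
    (k : ℕ) (hk : 1 ≤ k) (hkn : k ≤ Fintype.card V)
    (ε δ : ℝ) (hε : 0 < ε) (hε' : ε ≤ 1 / 3) (hδ : 0 < δ) (hδ' : δ ≤ 1 / 4)
    {Ω : Type*} [MeasurableSpace Ω] (μ : Measure Ω) [IsProbabilityMeasure μ]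
    -- the two pools of RR sets, each of them i.i.d., and the common size of the two samples
    (R₁ R₂ : ℕ → Ω → Set V) (M : Ω → ℕ)
    (hR₁ : ∀ i, HasLaw (R₁ i) G.rrSet.toMeasure μ) (hR₂ : ∀ i, HasLaw (R₂ i) G.rrSet.toMeasure μ)
    (hind₁ : iIndepFun R₁ μ) (hind₂ : iIndepFun R₂ μ)
    (hM : Measurable M)
    -- the second pool is independent of the first one and of the sample size
    (hind : IndepFun (fun ω => ((fun i => R₁ i ω), M ω)) (fun ω i => R₂ i ω) μ)
    -- the maintained invariant
    (hinv : ∀ᵐ ω ∂μ, kthLargest (degree (fun i => R₁ i ω) (M ω)) k =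
      ⌈upsilonOne ε (δ / Fintype.card V)⌉₊) :
    let B : ℝ := 4 * (Real.exp 1 - 2) * Real.log (2 * Fintype.card V / δ)
    let Ik : ℝ := kthLargest G.influence k
    let S : Ω → Set V := fun ω => queryAnswer ε k (fun i => R₁ i ω) (fun i => R₂ i ω) (M ω)
    1 - 2 * δ ≤ μ.real {ω |
        (∀ v, Ik ≤ G.influence v → v ∈ S ω) ∧
        ∀ u ∈ S ω, ((1 - ε ^ 2 / B) * ((1 - ε) ^ 2 / (1 + ε)) - ε) * Ik ≤ G.influence u} ∧
      (1 - 61 / 15 * ε) * Ik ≤ ((1 - ε ^ 2 / B) * ((1 - ε) ^ 2 / (1 + ε)) - ε) * Ik := by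
  intro B Ik S
  set n : ℝ := (Fintype.card V : ℝ)
  have hn1 : 1 ≤ n := Nat.one_le_cast.2 Fintype.card_pos
  have hn0 : 0 < n := by linarith
  have hB : 2 ≤ B := two_le_four_mul_log (by rw [le_div_iff₀ hδ]; linarith)
  have hIk : 1 ≤ Ik := by
    refine (isGreatest_kthLargest G.influence hk hkn).2 ?_
    have : {v | 1 ≤ G.influence v} = Set.univ := Set.eq_univ_of_forall G.one_le_influence
    rw [Set.mem_ofPred_eq, this, Set.ncard_univ, Nat.card_eq_fintype_card]
    exact hkn
  refine ⟨?_, mul_le_mul_of_nonneg_right (one_sub_le_trackingFactor hε hε' hB) (by linarith)⟩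
  set c := (1 - ε ^ 2 / B) * ((1 - ε) ^ 2 / (1 + ε)) - ε with hc
  set m := ⌈upsilonOne ε (δ / n)⌉₊
  set q : V → ℝ := fun u => G.rrSet.toMeasure.real {s | u ∈ s}
  have hGq : ∀ u, G.influence u = n * q u := G.influence_eq
  set p := Ik / n with hp
  have hp0 : 0 < p := by positivity
  have hpn : n * p = Ik := by rw [hp]; field_simp
  set Y := upsilon ε (δ / n) with hY
  have hYB : Y = B / ε ^ 2 := by
    rw [hY, upsilon, div_div_eq_mul_div]
  have hY0 : 0 < Y := by rw [hYB]; positivity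
  have hmY : 1 + (1 + ε) * Y ≤ m := Nat.le_ceil _
  have hm0 : (0 : ℝ) < m := by nlinarith
  have hδn : δ / n ≤ 2 := by rw [div_le_iff₀ hn0]; linarith
  have hδn0 : 0 < δ / n := by positivity
  have hmu : Y ≤ m / (1 + ε) := by rw [le_div_iff₀ (by linarith)]; linarith
  -- With high probability the sample size `M` lies between the deterministic `N` and `U`.
  set N := ⌈m / ((1 + ε) * p)⌉₊
  set U := ⌈m / ((1 - ε) * p)⌉₊
  have hε1 : 0 < 1 - ε := by linarith
  have hNp : m / (1 + ε) ≤ N * p := by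
    rw [← div_le_iff₀ hp0, div_div]; exact Nat.le_ceil _
  have hUp : m / (1 - ε) ≤ U * p := by
    rw [← div_le_iff₀ hp0, div_div]; exact Nat.le_ceil _
  have hN1p : ((N - 1 : ℕ) : ℝ) * p ≤ m / (1 + ε) := by
    rw [← le_div_iff₀ hp0, div_div]
    have h1 : 0 < N := Nat.ceil_pos.2 (by positivity)
    have h2 : (N : ℝ) < m / ((1 + ε) * p) + 1 := Nat.ceil_lt_add_one (by positivity)
    rw [Nat.cast_pred h1]
    linarith
  have hp1 : p ≤ 1 := by
    obtain ⟨v, hv⟩ := (Set.ncard_pos (Set.toFinite _)).1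
      (hk.trans (isGreatest_kthLargest G.influence hk hkn).1)
    have h1 : n * p ≤ n * q v := by rw [hpn, ← hGq]; exact hv
    exact (le_of_mul_le_mul_left h1 hn0).trans measureReal_le_one
  have hle : ∀ u, G.influence u ≤ Ik → q u ≤ p := fun u hu =>
    le_of_mul_le_mul_left (by rw [hpn, ← hGq]; exact hu) hn0
  have hge : ∀ u, Ik ≤ G.influence u → p ≤ q u := fun u hu =>
    le_of_mul_le_mul_left (by rw [hpn, ← hGq]; exact hu) hn0
  have hYU : Y ≤ m / (1 - ε) := hmu.trans (by gcongr; linarith)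
  set x := ε ^ 2 / B with hx
  have hx0 : 0 ≤ x := by positivity
  have hx1 : x ≤ 1 := by rw [hx, div_le_one (by linarith)]; nlinarith
  have hxY : x * Y = 1 := by rw [hx, hYB]; field_simp
  -- As `ε ^ 2 / B = 1 / Υ`, the factor `1 - ε ^ 2 / B` pays for rounding `U` up.
  have hxm : 1 ≤ x * m := by
    have h1 : x * (1 + (1 + ε) * Y) ≤ x * m := mul_le_mul_of_nonneg_left hmY hx0
    have h2 : x * (1 + (1 + ε) * Y) = x + (1 + ε) * (x * Y) := by ring
    rw [hxY] at h2
    linarith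
  have hthr : (U : ℝ) * (c * p) + ε * (U * p) ≤ (1 - ε) / (1 + ε) * m :=
    mul_trackingFactor_add_le hε (by linarith) hx1 hp0 hp1 hm0.le hxm
  have hfac : c + ε ≤ 1 := by
    rw [hc, sub_add_cancel]
    exact trackingFactor_add_le_one hε (by linarith) hx0
  have hδ2 : 0 ≤ δ / n / 2 := by positivity
  set D₁ : ℕ → V → Ω → ℝ := fun i u ω => degree (fun i => R₁ i ω) i u
  set D₂ : ℕ → V → Ω → ℝ := fun i u ω => degree (fun i => R₂ i ω) i u
  -- The four bad events of a vertex: its degree crosses a threshold at one of the fixed sample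
  -- sizes `N - 1`, `N`, `U`. Each has probability at most `δ / (2 n)`.
  let A₁ : V → Set Ω := fun u => {ω | G.influence u ≤ Ik ∧ ω ∈ {ω | (m : ℝ) ≤ D₁ (N - 1) u ω}}
  let A₂ : V → Set Ω := fun u =>
    {ω | Ik ≤ G.influence u ∧ ω ∈ {ω | D₂ N u ω ≤ (1 - ε) / (1 + ε) * m}}
  let A₃ : V → Set Ω := fun u => {ω | Ik ≤ G.influence u ∧ ω ∈ {ω | D₁ U u ω ≤ m}}
  let A₄ : V → Set Ω := fun u =>
    {ω | G.influence u < c * Ik ∧ ω ∈ {ω | (1 - ε) / (1 + ε) * m ≤ D₂ U u ω}}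
  have hA₁ : ∀ u, μ.real (A₁ u) ≤ δ / n / 2 := fun u =>
    measureReal_setOf_and_le hδ2 fun hu => by
      have h1 : ((N - 1 : ℕ) : ℝ) * q u ≤ m / (1 + ε) :=
        (mul_le_mul_of_nonneg_left (hle u hu) (Nat.cast_nonneg _)).trans hN1p
      refine (measure_degree_ge_le hR₁ hind₁ u hε.le h1 ?_).trans
        (exp_neg_le_of_upsilon_le hε hδn0 hδn (by linarith) (by linarith) hmu)
      calc ((N - 1 : ℕ) : ℝ) * q u + ε * (m / (1 + ε)) ≤ m / (1 + ε) + ε * (m / (1 + ε)) := by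
            gcongr
        _ = m := by field_simp
  have hA₂ : ∀ u, μ.real (A₂ u) ≤ δ / n / 2 := fun u =>
    measureReal_setOf_and_le hδ2 fun hu =>
      (measure_degree_le_le hR₂ hind₂ u hε.le
        (hNp.trans (mul_le_mul_of_nonneg_left (hge u hu) (Nat.cast_nonneg _)))
        (by rw [div_mul_eq_mul_div, mul_div_assoc]) (by positivity)).trans
        (exp_neg_le_of_upsilon_le hε hδn0 hδn (by linarith) (by norm_num) hmu)
  have hA₃ : ∀ u, μ.real (A₃ u) ≤ δ / n / 2 := fun u =>
    measureReal_setOf_and_le hδ2 fun hu =>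
      (measure_degree_le_le hR₁ hind₁ u hε.le
        (hUp.trans (mul_le_mul_of_nonneg_left (hge u hu) (Nat.cast_nonneg _)))
        (by rw [mul_div_cancel₀ _ hε1.ne']) (by positivity)).trans
        (exp_neg_le_of_upsilon_le hε hδn0 hδn (by linarith) (by norm_num) hYU)
  have hA₄ : ∀ u, μ.real (A₄ u) ≤ δ / n / 2 := fun u =>
    measureReal_setOf_and_le hδ2 fun hu => by
      have h1 : q u ≤ c * p := by
        refine le_of_mul_le_mul_left ?_ hn0
        rw [mul_left_comm, hpn, ← hGq]
        exact hu.le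
      have h2 : (U : ℝ) * q u ≤ U * (c * p) := mul_le_mul_of_nonneg_left h1 (Nat.cast_nonneg _)
      have h3 : (U : ℝ) * (c * p) ≤ U * p := by
        refine mul_le_mul_of_nonneg_left ?_ (Nat.cast_nonneg _)
        exact mul_le_of_le_one_left hp0.le (by linarith)
      exact (measure_degree_ge_le hR₂ hind₂ u hε.le (h2.trans h3) (by linarith)).trans
        (exp_neg_le_of_upsilon_le hε hδn0 hδn (by linarith) (by linarith) (hYU.trans hUp))
  have hfour : ∀ u, μ.real (A₁ u ∪ A₂ u ∪ A₃ u ∪ A₄ u) ≤ 2 * (δ / n) := fun u => by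
    linarith [measureReal_union_le (μ := μ) (A₁ u ∪ A₂ u ∪ A₃ u) (A₄ u),
      measureReal_union_le (μ := μ) (A₁ u ∪ A₂ u) (A₃ u),
      measureReal_union_le (μ := μ) (A₁ u) (A₂ u), hA₁ u, hA₂ u, hA₃ u, hA₄ u]
  have htot : n * (2 * (δ / n)) = 2 * δ := by field_simp
  rw [← htot]
  refine one_sub_le_measureReal_of_forall hfour (hinv.mono fun ω hω hgood => ?_)
  simp only [Set.mem_union, not_or] at hgood
  refine queryAnswer_spec (N := N) (U := U) hk hkn hω (fun u hu => ?_) (fun u hu => ?_)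
    (fun u hu => ?_) fun u hu => ?_
  · exact (Nat.cast_lt (α := ℝ)).1 (not_le.1 fun h => (hgood u).1.1.1 ⟨hu, h⟩)
  · exact not_le.1 fun h => (hgood u).1.1.2 ⟨hu, h⟩
  · exact (Nat.cast_lt (α := ℝ)).1 (not_le.1 fun h => (hgood u).1.2 ⟨hu, h⟩)
  · exact not_le.1 fun h => (hgood u).2 ⟨hu, h⟩
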